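/- Binary estimation with a helper. Let $S_1^n$ and $S_2^n$ be independent, with i.i.d. $\mathrm{Bern}(p_1)$ and i.i.d. $\mathrm{Bern}(p_2)$ letters respectively, where $0\le p_1,p_2\le 1/2$. A code of block length $n$ consists of an encoder $f:\{0,1\}^n\to\{0,1\}^n$, $X^n=f(S_2^n)$, and a decoder $g:\{0,1\}^n\to\{0,1\}^n$, $\hat S_1^n=g(Y^n)$, where $Y_i=X_i\oplus S_{1i}\oplus S_{2i}$. Its cost is $\mathbb E\,\frac1n\sum_{i=1}^n \mathbf 1\{X_i=1\}$ and its distortion is $\mathbb E\,\frac1n\sum_{i=1}^n \mathbf 1\{\hat S_{1i}\ne S_{1i}\}$. The code is causal if for each $i$ the letter $X_i$ is a function of $(S_{21},\dots,S_{2i})$ only; in the noncausal setting every encoder is allowed. A distortion $D$ is achievable under the cost constraint $C\ge 0$, in the noncausal (respectively causal) setting, if there are codes (respectively causal codes), one for each block length $n$, with cost at most $C+\epsilon_n$, where $\epsilon_n\to0$, and whose distortions have limit superior at most $D$ as $n\to\infty$. Let $D(C)_{\text{min-noncausal}}$ and $D(C)_{\text{min-causal}}$ be the infima of the achievable distortions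 in the two settings. Then, for some $p_1,p_2\in[0,1/2]$ and some $C\ge0$, $$D(C)_{\text{min-noncausal}}<D(C)_{\text{min-causal}}.$$ Specifically, for $p_1=0.1$, $p_2=0.5$ and $C=0.11$, the distortion $0$ is achievable in the noncausal setting, so that $D(0.11)_{\text{min-noncausal}}=0$, whereas $D(0.11)_{\text{min-causal}}>0$. -/

import Mathlib

open Filter Topology

noncomputable section

namespace BinaryHelper

/-- The binary alphabet; addition is exclusive or. -/
abbrev Bit := ZMod 2

/-- Binary words of length `n`. -/
abbrev Word (n : ℕ) := Fin n → Bit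

/-- The probability mass function of `Bern(p)`. -/
def bern (p : ℝ) (b : Bit) : ℝ := if b = 1 then p else 1 - p

/-- The probability of a word whose letters are i.i.d. `Bern(p)`. -/
def wordProb (p : ℝ) {n : ℕ} (s : Word n) : ℝ := ∏ i, bern p (s i)

/-- The expectation of `F (S₁ⁿ, S₂ⁿ)` for independent words `S₁ⁿ` (i.i.d. `Bern(p₁)`) and
`S₂ⁿ` (i.i.d. `Bern(p₂)`). -/
def expect (p₁ p₂ : ℝ) {n : ℕ} (F : Word n → Word n → ℝ) : ℝ :=
  ∑ s₁ : Word n, ∑ s₂ : Word n, wordProb p₁ s₁ * wordProb p₂ s₂ * F s₁ s₂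

/-- The cost of one input letter. -/
def letterCost (x : Bit) : ℝ := if x = 1 then 1 else 0

/-- The Hamming distortion between two letters. -/
def hamming (s t : Bit) : ℝ := if s = t then 0 else 1

/-- A code of block length `n`: the encoder maps the interference `S₂ⁿ` to `Xⁿ`, and the decoder
maps the output `Yⁿ` to the reconstruction of `S₁ⁿ`. -/
structure Code (n : ℕ) where
  enc : Word n → Word n
  dec : Word n → Word n

namespace Code

variable {n : ℕ}

/-- The channel output `Y = X ⊕ S₁ ⊕ S₂`, letter by letter. -/
def output (c : Code n) (s₁ s₂ : Word n) : Word n := fun i => c.enc s₂ i + s₁ i + s₂ i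

/-- The expected cost per letter. -/
def cost (c : Code n) (p₁ p₂ : ℝ) : ℝ :=
  expect p₁ p₂ fun _ s₂ => (∑ i, letterCost (c.enc s₂ i)) / n

/-- The expected Hamming distortion per letter. -/
def distortion (c : Code n) (p₁ p₂ : ℝ) : ℝ :=
  expect p₁ p₂ fun s₁ s₂ => (∑ i, hamming (s₁ i) (c.dec (c.output s₁ s₂) i)) / n

/-- The encoder is causal: its letter at time `i` is a function `f i` of the interference letters
up to and including time `i`. -/
def IsCausal (c : Code n) : Prop :=
  ∃ f : (i : Fin n) → Word (i.val + 1) → Bit,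
    ∀ (s₂ : Word n) (i : Fin n), c.enc s₂ i = f i fun j => s₂ (Fin.castLE i.isLt j)

end Code

/-- All codes: the interference is known noncausally. -/
def noncausal (n : ℕ) : Set (Code n) := Set.univ

/-- The codes with a causal encoder. -/
def causal (n : ℕ) : Set (Code n) := {c | c.IsCausal}

/-- The distortion `D` is achievable under the cost constraint `C` by codes of the class `𝒞`:
there are codes of cost at most `C + εₙ`, with `εₙ → 0`, whose distortion has limit superior at
most `D`. -/
def Achievable (𝒞 : (n : ℕ) → Set (Code n)) (p₁ p₂ C D : ℝ) : Prop :=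
  ∃ (c : (n : ℕ) → Code n) (ε : ℕ → ℝ),
    (∀ n, c n ∈ 𝒞 n) ∧ (∀ n, (c n).cost p₁ p₂ ≤ C + ε n) ∧ Tendsto ε atTop (𝓝 0) ∧
      limsup (fun n => (c n).distortion p₁ p₂) atTop ≤ D

/-- The minimum achievable distortion under the cost constraint `C`. -/
def minDistortion (𝒞 : (n : ℕ) → Set (Code n)) (p₁ p₂ C : ℝ) : ℝ :=
  sInf {D : ℝ | Achievable 𝒞 p₁ p₂ C D}

end BinaryHelper

end

namespace BinaryHelper

/-! Noncausal half: hash with a random linear map `H` to `m` bits. The encoder picks a light word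
`x` with `H x = u + H s₂`, so the output has hash `u + H s₁`; the decoder learns `H s₁` and searches
the typical words. This works once `2 ^ m` lies well between the number of typical words (weight at
most about `0.105 n`) and the number of admissible inputs (weight at most about `0.107 n`). These
sizes differ by an exponential factor, since one more unit of radius at least doubles a ball of
radius below `n / 3`. The lemmas are `exists_hash`, `exists_code` and `two_pow_mul_card_ball_le`.

Causal half: the output is `s₁ + v` with `v = x(s₂) + s₂`. Reading `s₂` letter by letter, two
branches can give the same letter of `v` only where the input reacts to the current letter, that is,
at a sensitive time. So a word with `k` sensitive times is confused with about `2 ^ k` words at most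
(`CausalMap.kraft`). A sensitive time costs on average half a unit of input, so at cost `0.11` the
mean of `k` is at most about `0.22 n`, and `k < n / 4` has probability bounded below. There `v`
keeps over `3 n / 4` bits of randomness, too many for the decoder to recover `s₁` with few errors;
`Code.IsCausal.one_le` makes this a finite-length bound. -/

theorem bit_cases (b : Bit) : b = 0 ∨ b = 1 := by
  revert b; decide

theorem bit_sum {M : Type*} [AddCommMonoid M] (f : Bit → M) : ∑ b, f b = f 0 + f 1 :=
  Fin.sum_univ_two f

/-! ### Generating functions of weight and distance. -/

theorem sum_word_prod {n : ℕ} (F : Fin n → Bit → ℝ) :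
    ∑ s : Word n, ∏ i, F i (s i) = ∏ i, (F i 0 + F i 1) := by
  simp_rw [← bit_sum]
  rw [Finset.prod_univ_sum, Fintype.piFinset_univ]

/-- The Hamming weight of a word. -/
def weight {n : ℕ} (s : Word n) : ℕ := (Finset.univ.filter fun i => s i = 1).card

/-- The Hamming distance of two words. -/
def dist {n : ℕ} (s t : Word n) : ℕ := (Finset.univ.filter fun i => ¬ s i = t i).card

theorem pow_weight {n : ℕ} (z : ℝ) (s : Word n) :
    z ^ weight s = ∏ i, if s i = 1 then z else 1 := by
  rw [Finset.prod_ite, Finset.prod_const, Finset.prod_const_one, mul_one, weight]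

theorem pow_dist {n : ℕ} (z : ℝ) (s t : Word n) :
    z ^ dist s t = ∏ i, if s i = t i then 1 else z := by
  rw [Finset.prod_ite, Finset.prod_const_one, Finset.prod_const, one_mul, dist]

theorem sum_pow_dist {n : ℕ} (z : ℝ) (t : Word n) : ∑ s, z ^ dist s t = (1 + z) ^ n := by
  simp_rw [pow_dist]
  rw [sum_word_prod fun i b => if b = t i then (1 : ℝ) else z]
  rw [Finset.prod_congr rfl (g := fun _ => 1 + z), Finset.prod_const, Finset.card_univ,
    Fintype.card_fin]
  intro i _
  rcases bit_cases (t i) with h | h <;> simp [h, add_comm]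

theorem sum_wordProb_mul_pow_weight {n : ℕ} (p z : ℝ) :
    ∑ s : Word n, wordProb p s * z ^ weight s = (1 - p + p * z) ^ n := by
  simp_rw [pow_weight, wordProb, ← Finset.prod_mul_distrib]
  rw [sum_word_prod fun _ b => bern p b * if b = 1 then z else 1]
  simp [bern]

theorem sum_wordProb {n : ℕ} (p : ℝ) : ∑ s : Word n, wordProb p s = 1 := by
  simpa using sum_wordProb_mul_pow_weight (n := n) p 1

theorem wordProb_nonneg {n : ℕ} {p : ℝ} (h0 : 0 ≤ p) (h1 : p ≤ 1) (s : Word n) :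
    0 ≤ wordProb p s := by
  refine Finset.prod_nonneg fun i _ => ?_
  unfold bern
  split_ifs <;> linarith

theorem wordProb_half {n : ℕ} (s : Word n) : wordProb (0.5 : ℝ) s = (1 / 2) ^ n := by
  have h : ∀ b, bern (0.5 : ℝ) b = 1 / 2 := fun b => by unfold bern; split_ifs <;> norm_num
  simp [wordProb, h]

theorem wordProb_eq {n : ℕ} {p : ℝ} (hp : 1 - p ≠ 0) (s : Word n) :
    wordProb p s = (1 - p) ^ n * (p / (1 - p)) ^ weight s := by
  have h : (1 - p) ^ n = ∏ _i : Fin n, (1 - p) := by simp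
  rw [pow_weight, h, wordProb, ← Finset.prod_mul_distrib]
  refine Finset.prod_congr rfl fun i _ => ?_
  unfold bern
  split_ifs
  · field_simp
  · ring

/-! ### Expectations, and elementary bounds on distortion. -/

section Expect

variable {n : ℕ} {p₁ p₂ : ℝ}

theorem expect_add (F G : Word n → Word n → ℝ) :
    expect p₁ p₂ (fun s t => F s t + G s t) = expect p₁ p₂ F + expect p₁ p₂ G := by
  simp only [expect, mul_add, Finset.sum_add_distrib]

theorem expect_const_mul (a : ℝ) (F : Word n → Word n → ℝ) :
    expect p₁ p₂ (fun s t => a * F s t) = a * expect p₁ p₂ F := by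
  simp only [expect, Finset.mul_sum]
  exact Finset.sum_congr rfl fun s _ => Finset.sum_congr rfl fun t _ => by ring

theorem expect_fst (F : Word n → ℝ) :
    expect p₁ p₂ (fun s _ => F s) = ∑ s, wordProb p₁ s * F s := by
  simp only [expect]
  refine Finset.sum_congr rfl fun s _ => ?_
  rw [← Finset.sum_mul, ← Finset.mul_sum, sum_wordProb, mul_one]

theorem expect_snd (F : Word n → ℝ) :
    expect p₁ p₂ (fun _ t => F t) = ∑ t, wordProb p₂ t * F t := by
  rw [expect, Finset.sum_comm]
  refine Finset.sum_congr rfl fun s _ => ?_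
  rw [← Finset.sum_mul, ← Finset.sum_mul, sum_wordProb, one_mul]

theorem expect_const (a : ℝ) : expect p₁ p₂ (fun (_ _ : Word n) => a) = a := by
  rw [expect_fst, ← Finset.sum_mul, sum_wordProb, one_mul]

theorem expect_mono (h₁ : 0 ≤ p₁) (h₁' : p₁ ≤ 1) (h₂ : 0 ≤ p₂) (h₂' : p₂ ≤ 1)
    {F G : Word n → Word n → ℝ} (h : ∀ s t, F s t ≤ G s t) :
    expect p₁ p₂ F ≤ expect p₁ p₂ G :=
  Finset.sum_le_sum fun s _ => Finset.sum_le_sum fun t _ =>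
    mul_le_mul_of_nonneg_left (h s t)
      (mul_nonneg (wordProb_nonneg h₁ h₁' s) (wordProb_nonneg h₂ h₂' t))

end Expect

theorem sum_hamming {n : ℕ} (s t : Word n) : ∑ i, hamming (s i) (t i) = dist s t := by
  simp only [hamming, dist, Finset.card_filter, Nat.cast_sum]
  refine Finset.sum_congr rfl fun i _ => ?_
  split_ifs <;> simp_all

theorem sum_letterCost {n : ℕ} (s : Word n) : ∑ i, letterCost (s i) = weight s := by
  simp only [letterCost, weight, Finset.card_filter, Nat.cast_sum]
  refine Finset.sum_congr rfl fun i _ => ?_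
  split_ifs <;> simp_all

theorem dist_le {n : ℕ} (s t : Word n) : dist s t ≤ n :=
  (Finset.card_le_univ _).trans_eq (Fintype.card_fin n)

theorem dist_self {n : ℕ} (s : Word n) : dist s s = 0 := by simp [dist]

namespace Code

variable {n : ℕ} {p₁ p₂ : ℝ}

theorem distortion_eq (c : Code n) :
    c.distortion p₁ p₂ =
      expect p₁ p₂ fun s₁ s₂ => (dist s₁ (c.dec (c.output s₁ s₂)) : ℝ) / n := by
  simp only [distortion, sum_hamming]

theorem cost_eq (c : Code n) :
    c.cost p₁ p₂ = expect p₁ p₂ fun _ s₂ => (weight (c.enc s₂) : ℝ) / n := by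
  simp only [cost, sum_letterCost]

theorem distortion_nonneg (h₁ : 0 ≤ p₁) (h₁' : p₁ ≤ 1) (h₂ : 0 ≤ p₂) (h₂' : p₂ ≤ 1)
    (c : Code n) : 0 ≤ c.distortion p₁ p₂ := by
  rw [distortion_eq, ← expect_const (n := n) (p₁ := p₁) (p₂ := p₂) 0]
  exact expect_mono h₁ h₁' h₂ h₂' fun s t => by positivity

theorem distortion_le_one (h₁ : 0 ≤ p₁) (h₁' : p₁ ≤ 1) (h₂ : 0 ≤ p₂) (h₂' : p₂ ≤ 1)
    (c : Code n) : c.distortion p₁ p₂ ≤ 1 := by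
  rw [distortion_eq, ← expect_const (n := n) (p₁ := p₁) (p₂ := p₂) 1]
  exact expect_mono h₁ h₁' h₂ h₂' fun s t =>
    div_le_one_of_le₀ (by exact_mod_cast dist_le _ _) (by positivity)

end Code

theorem isBoundedUnder_distortion {p₁ p₂ : ℝ} (h₁ : 0 ≤ p₁) (h₁' : p₁ ≤ 1) (h₂ : 0 ≤ p₂)
    (h₂' : p₂ ≤ 1) (c : (n : ℕ) → Code n) :
    IsBoundedUnder (· ≤ ·) atTop fun n => (c n).distortion p₁ p₂ :=
  isBoundedUnder_of ⟨1, fun n => (c n).distortion_le_one h₁ h₁' h₂ h₂'⟩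

/-- A lower bound on the distortion of the admissible codes of large block length is a lower
bound on the achievable distortions. -/
theorem le_of_achievable {𝒞 : (n : ℕ) → Set (Code n)} {p₁ p₂ C D δ : ℝ} (h₁ : 0 ≤ p₁)
    (h₁' : p₁ ≤ 1) (h₂ : 0 ≤ p₂) (h₂' : p₂ ≤ 1)
    (h : ∀ (c : (n : ℕ) → Code n) (ε : ℕ → ℝ), (∀ n, c n ∈ 𝒞 n) →
      (∀ n, (c n).cost p₁ p₂ ≤ C + ε n) → Tendsto ε atTop (𝓝 0) →
      ∀ᶠ n in atTop, δ ≤ (c n).distortion p₁ p₂)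
    (hD : Achievable 𝒞 p₁ p₂ C D) : δ ≤ D := by
  obtain ⟨c, ε, hc, hcost, hε, hlim⟩ := hD
  -- A real `limsup` is meaningful only for bounded sequences; distortions lie in `[0, 1]`.
  exact (le_limsup_of_frequently_le (h c ε hc hcost hε).frequently
    (isBoundedUnder_distortion h₁ h₁' h₂ h₂' c)).trans hlim

theorem nonneg_of_achievable {𝒞 : (n : ℕ) → Set (Code n)} {p₁ p₂ C D : ℝ} (h₁ : 0 ≤ p₁)
    (h₁' : p₁ ≤ 1) (h₂ : 0 ≤ p₂) (h₂' : p₂ ≤ 1) (hD : Achievable 𝒞 p₁ p₂ C D) : 0 ≤ D :=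
  le_of_achievable h₁ h₁' h₂ h₂'
    (fun c _ _ _ _ => Eventually.of_forall fun n => (c n).distortion_nonneg h₁ h₁' h₂ h₂') hD

/-- Sending nothing is causal and free, and has distortion at most one. -/
theorem achievable_causal_one {p₁ p₂ C : ℝ} (h₁ : 0 ≤ p₁) (h₁' : p₁ ≤ 1) (h₂ : 0 ≤ p₂)
    (h₂' : p₂ ≤ 1) (hC : 0 ≤ C) : Achievable causal p₁ p₂ C 1 := by
  refine ⟨fun n => ⟨fun _ => 0, id⟩, 0, fun n => ⟨fun _ _ => 0, fun _ _ => rfl⟩, fun n => ?_,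
    tendsto_const_nhds, ?_⟩
  · rw [Code.cost_eq]
    simpa [weight, expect_const] using hC
  · refine limsup_le_of_le ?_ (Eventually.of_forall fun n => Code.distortion_le_one h₁ h₁' h₂ h₂' _)
    exact (isBoundedUnder_of (r := (· ≥ ·))
      ⟨0, fun n => Code.distortion_nonneg h₁ h₁' h₂ h₂' _⟩).isCoboundedUnder_le

/-! ### Sensitive times and the Kraft inequality for causal encoders. -/

section Causal

variable {n : ℕ}

/-- The word `s` with its letter `i` flipped. -/
def flip (s : Word n) (i : Fin n) : Word n := Function.update s i (s i + 1)

theorem flip_flip (s : Word n) (i : Fin n) : flip (flip s i) i = s := by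
  have h : s i + 1 + 1 = s i := by rw [add_assoc, show (1 + 1 : Bit) = 0 from rfl, add_zero]
  simp [flip, h]

/-- The times at which the letter `x s i` depends on the letter `s i`. -/
def sensitive (x : Word n → Word n) (s : Word n) : Finset (Fin n) :=
  Finset.univ.filter fun i => ¬ x s i = x (flip s i) i

/-- Each letter of `x s` depends only on the letters of `s` up to the same time. -/
def CausalMap (x : Word n → Word n) : Prop :=
  ∀ (i : Fin n) (s t : Word n), (∀ j ≤ i, s j = t j) → x s i = x t i

theorem Code.IsCausal.causalMap {c : Code n} (h : c.IsCausal) : CausalMap c.enc := by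
  obtain ⟨f, hf⟩ := h
  intro i s t hst
  rw [hf, hf]
  congr 1
  ext j
  rw [hst]
  exact Fin.le_def.2 (Nat.lt_succ_iff.1 j.isLt)

/-- The transmitter map after the first letter, once this letter is known to be `b`. -/
def tailMap (x : Word (n + 1) → Word (n + 1)) (b : Bit) (s : Word n) : Word n :=
  fun i => x (Fin.cons b s : Word (n + 1)) i.succ

theorem CausalMap.tail {x : Word (n + 1) → Word (n + 1)} (hx : CausalMap x) (b : Bit) :
    CausalMap (tailMap x b) := by
  intro i s t hst
  refine hx _ _ _ fun j hj => ?_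
  induction j using Fin.cases with
  | zero => rfl
  | succ j => simpa using hst j (by simpa using hj)

theorem CausalMap.apply_cons_zero {x : Word (n + 1) → Word (n + 1)} (hx : CausalMap x) (b : Bit)
    (s t : Word n) : x (Fin.cons b s : Word (n + 1)) 0 = x (Fin.cons b t : Word (n + 1)) 0 := by
  refine hx _ _ _ fun j hj => ?_
  rw [Fin.le_zero_iff.1 hj]
  rfl

theorem flip_cons_zero (b : Bit) (s : Word n) :
    flip (Fin.cons b s : Word (n + 1)) 0 = (Fin.cons (b + 1) s : Word (n + 1)) := by
  simp [flip, Fin.update_cons_zero]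

theorem flip_cons_succ (b : Bit) (s : Word n) (i : Fin n) :
    flip (Fin.cons b s : Word (n + 1)) i.succ = (Fin.cons b (flip s i) : Word (n + 1)) := by
  simp [flip, Fin.cons_update]

theorem card_sensitive_cons {x : Word (n + 1) → Word (n + 1)} (hx : CausalMap x) (b : Bit)
    (s : Word n) : (sensitive x (Fin.cons b s : Word (n + 1))).card =
      (if x (Fin.cons b 0 : Word (n + 1)) 0 = x (Fin.cons (b + 1) 0 : Word (n + 1)) 0
        then 0 else 1) + (sensitive (tailMap x b) s).card := by
  simp only [sensitive, Finset.card_filter, Fin.sum_univ_succ, flip_cons_zero, flip_cons_succ]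
  rw [hx.apply_cons_zero b s 0, hx.apply_cons_zero (b + 1) s 0]
  congr 1
  exact ite_not ..

/-- One level of the Kraft tree. If `f` is constant, `f b + b` determines `b`, so one branch
survives with weight `1`. Otherwise `f b + b` is constant in `b`, and both branches survive or
neither does, each with weight `1 / 2`. -/
theorem sum_branch_le_one (f : Bit → Bit) (v : Bit) :
    ∑ b, (if f b + b = v then ((1 : ℝ) / 2) ^ (if f b = f (b + 1) then 0 else 1) else 0) ≤ 1 := by
  rw [bit_sum, zero_add, show (1 + 1 : Bit) = 0 from rfl]
  have h0 := bit_cases (f 0)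
  have h1 := bit_cases (f 1)
  have hv := bit_cases v
  have e : (1 + 1 : Bit) = 0 := rfl
  rcases h0 with h0 | h0 <;> rcases h1 with h1 | h1 <;> rcases hv with hv | hv <;>
    simp [h0, h1, hv, e] <;> norm_num

/-- A Kraft inequality: a word `v` is of the form `x s + s` for at most `2 ^ k` words `s` with `k`
sensitive times, in a weighted sense. -/
theorem CausalMap.kraft {n : ℕ} {x : Word n → Word n} (hx : CausalMap x) (v : Word n) :
    ∑ s, (if x s + s = v then ((1 : ℝ) / 2) ^ (sensitive x s).card else 0) ≤ 1 := by
  induction n with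
  | zero =>
    rw [Fintype.sum_unique]
    split_ifs
    · exact pow_le_one₀ (by norm_num) (by norm_num)
    · exact zero_le_one
  | succ n ih =>
    rw [← (Fin.consEquiv fun _ => Bit).sum_comp, Fintype.sum_prod_type]
    -- By causality the first input letter depends only on `b`, so the words `0` stand for any
    -- continuation.
    refine le_trans (Finset.sum_le_sum fun b _ => ?_)
      (sum_branch_le_one (fun b => x (Fin.cons b 0 : Word (n + 1)) 0) (v 0))
    have key : ∀ s : Word n, x (Fin.cons b s : Word (n + 1)) + (Fin.cons b s : Word (n + 1)) = v ↔
        x (Fin.cons b 0 : Word (n + 1)) 0 + b = v 0 ∧ tailMap x b s + s = Fin.tail v := by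
      intro s
      rw [funext_iff, Fin.forall_fin_succ, funext_iff]
      simp only [Pi.add_apply, Fin.cons_zero, Fin.cons_succ, tailMap, Fin.tail]
      rw [hx.apply_cons_zero b s 0]
    change ∑ s : Word n, (if x (Fin.cons b s : Word (n + 1)) + (Fin.cons b s : Word (n + 1)) = v
      then ((1 : ℝ) / 2) ^ (sensitive x (Fin.cons b s : Word (n + 1))).card else 0) ≤ _
    simp only [key, card_sensitive_cons hx, pow_add]
    generalize ha : ((1 : ℝ) / 2) ^ (if x (Fin.cons b 0 : Word (n + 1)) 0 =
      x (Fin.cons (b + 1) 0 : Word (n + 1)) 0 then 0 else 1) = a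
    have ha0 : 0 ≤ a := ha ▸ by positivity
    by_cases h0 : x (Fin.cons b 0 : Word (n + 1)) 0 + b = v 0
    · have h := mul_le_mul_of_nonneg_left (ih (hx.tail b) (Fin.tail v)) ha0
      simpa only [h0, true_and, if_true, Finset.mul_sum, mul_ite, mul_zero, mul_one] using h
    · simp only [h0, false_and, if_false, Finset.sum_const_zero, le_refl]

/-- Sensitive times are paid for: one of the two values of the letter is `1`. -/
theorem sum_card_sensitive_le (x : Word n → Word n) :
    ∑ s, ((sensitive x s).card : ℝ) ≤ 2 * ∑ s, (weight (x s) : ℝ) := by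
  simp only [sensitive, weight, Finset.card_filter, Nat.cast_sum]
  rw [Finset.sum_comm, Finset.sum_comm (f := fun s i => ((if x s i = 1 then 1 else 0 : ℕ) : ℝ)),
    Finset.mul_sum]
  refine Finset.sum_le_sum fun i _ => ?_
  -- Pairing `s` with its flip at `i` counts the ones at both ends of the pair.
  have hinv : Function.Involutive fun s : Word n => flip s i := fun s => flip_flip s i
  have h := Equiv.sum_comp (hinv.toPerm _) fun s => ((if x s i = 1 then 1 else 0 : ℕ) : ℝ)
  rw [two_mul]
  nth_rewrite 2 [← h]
  rw [← Finset.sum_add_distrib]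
  refine Finset.sum_le_sum fun s _ => ?_
  simp only [Function.Involutive.coe_toPerm]
  rcases bit_cases (x s i) with h0 | h0 <;> rcases bit_cases (x (flip s i) i) with h1 | h1 <;>
    simp [h0, h1]

/-- The sum over the pairs of words weighted by the number of sensitive times and by the error of
the decoder `g`. -/
theorem CausalMap.sum_sensitive_dist_le {x : Word n → Word n} (hx : CausalMap x)
    (g : Word n → Word n) {z : ℝ} (hz : 0 ≤ z) :
    ∑ s₁ : Word n, ∑ s₂ : Word n, ((1 : ℝ) / 2) ^ (sensitive x s₂).card *
      z ^ dist s₁ (g (x s₂ + s₁ + s₂)) ≤ 2 ^ n * (1 + z) ^ n := by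
  have hy : ∀ s₁ s₂ : Word n, ((1 : ℝ) / 2) ^ (sensitive x s₂).card *
      z ^ dist s₁ (g (x s₂ + s₁ + s₂)) = ∑ y : Word n, z ^ dist s₁ (g y) *
        (if x s₂ + s₂ = y - s₁ then ((1 : ℝ) / 2) ^ (sensitive x s₂).card else 0) := by
    intro s₁ s₂
    -- Sorting by the output `y` fixes the decoder's estimate, and leaves for each `s₁` a Kraft sum
    -- over `s₂`.
    rw [Finset.sum_eq_single (x s₂ + s₁ + s₂)]
    · rw [if_pos (by abel), mul_comm]
    · intro y _ hy
      rw [if_neg, mul_zero]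
      intro h
      apply hy
      rw [← sub_add_cancel y s₁, ← h]
      abel
    · simp
  simp only [hy]
  calc _ = ∑ y : Word n, ∑ s₁ : Word n, z ^ dist s₁ (g y) * ∑ s₂ : Word n,
        (if x s₂ + s₂ = y - s₁ then ((1 : ℝ) / 2) ^ (sensitive x s₂).card else 0) := by
        simp_rw [Finset.mul_sum]
        rw [Finset.sum_comm]
        rw [Finset.sum_congr rfl fun s₂ _ => Finset.sum_comm, Finset.sum_comm]
        exact Finset.sum_congr rfl fun y _ => Finset.sum_comm
    _ ≤ ∑ y : Word n, ∑ s₁ : Word n, z ^ dist s₁ (g y) * 1 :=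
        Finset.sum_le_sum fun y _ => Finset.sum_le_sum fun s₁ _ =>
          mul_le_mul_of_nonneg_left (hx.kraft _) (by positivity)
    _ = 2 ^ n * (1 + z) ^ n := by
        simp only [mul_one, sum_pow_dist, Finset.sum_const, Finset.card_univ, nsmul_eq_mul]
        simp [ZMod.card]

end Causal

/-! ### Exponential bounds with roots in place of fractional exponents. -/

theorem one_le_pow_mul_pow_inv {a b : ℝ} {m k n : ℕ} (ha : 1 ≤ a) (hab : a ^ m = b)
    (h : m * k ≤ n) : 1 ≤ a ^ n * (1 / b) ^ k := by
  have h0 : 0 < a := by linarith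
  rw [← hab, one_div, inv_pow, ← pow_mul, ← div_eq_mul_inv, one_le_div (by positivity)]
  exact pow_le_pow_right₀ ha h

theorem one_le_inv_pow_mul_pow {a b : ℝ} {m k n : ℕ} (ha : 1 ≤ a) (hab : a ^ m = b)
    (h : n ≤ m * k) : 1 ≤ (1 / a) ^ n * b ^ k := by
  have h0 : 0 < a := by linarith
  rw [← hab, one_div, inv_pow, ← pow_mul, mul_comm, ← div_eq_mul_inv, one_le_div (by positivity)]
  exact pow_le_pow_right₀ ha h

theorem exists_one_le_pow_eq {b : ℝ} (hb : 1 ≤ b) {m : ℕ} (hm : m ≠ 0) :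
    ∃ a : ℝ, 1 ≤ a ∧ a ^ m = b :=
  ⟨b ^ (1 / (m : ℝ)), Real.one_le_rpow hb (by positivity), by
    rw [one_div, Real.rpow_inv_natCast_pow (by linarith) hm]⟩

/-! ### The converse for causal codes. -/

section Converse

variable {n : ℕ}

/-- A union bound in pointwise form: many errors, many sensitive times and an atypically light `s₁`
each make one of the first three terms at least `1`. In the remaining case all three factors of the
last term are at least `1`. -/
theorem one_le_converse_sum (hn : 0 < n) {u v r η : ℝ} (hu : 1 ≤ u) (hu' : u ^ 20 = 9)
    (hv : 1 ≤ v) (hv' : v ^ 20 = 2) (hr : 1 ≤ r) (hr' : r ^ 4 = 2) (hη : 1 ≤ η)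
    (hη' : η ^ 400 = 50) (d k w : ℕ) :
    1 ≤ 400 * ((d : ℝ) / n) + 4 * ((k : ℝ) / n) + v ^ n * (1 / 2) ^ w +
      (r * η * (1 / u)) ^ n * ((1 / 2) ^ k * (1 / 50) ^ d * 9 ^ w) := by
  have hn' : (0 : ℝ) < n := by exact_mod_cast hn
  have h1 : 0 ≤ 400 * ((d : ℝ) / n) := by positivity
  have h2 : 0 ≤ 4 * ((k : ℝ) / n) := by positivity
  have h3 : 0 ≤ v ^ n * (1 / 2 : ℝ) ^ w := by positivity
  have h4 : 0 ≤ (r * η * (1 / u)) ^ n * ((1 / 2 : ℝ) ^ k * (1 / 50) ^ d * 9 ^ w) := by positivity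
  by_cases hd : n ≤ 400 * d
  · have : (1 : ℝ) ≤ 400 * ((d : ℝ) / n) := by
      rw [← mul_div_assoc, one_le_div hn']
      exact_mod_cast hd
    linarith
  by_cases hk : n ≤ 4 * k
  · have : (1 : ℝ) ≤ 4 * ((k : ℝ) / n) := by
      rw [← mul_div_assoc, one_le_div hn']
      exact_mod_cast hk
    linarith
  by_cases hw : 20 * w ≤ n
  · have := one_le_pow_mul_pow_inv hv hv' hw
    linarith
  have e1 := one_le_pow_mul_pow_inv hr hr' (not_le.1 hk).le
  have e2 := one_le_pow_mul_pow_inv hη hη' (not_le.1 hd).le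
  have e3 := one_le_inv_pow_mul_pow hu hu' (not_le.1 hw).le
  have e := one_le_mul_of_one_le_of_one_le (one_le_mul_of_one_le_of_one_le e1 e2) e3
  have : (r * η * (1 / u)) ^ n * ((1 / 2 : ℝ) ^ k * (1 / 50) ^ d * 9 ^ w) =
      r ^ n * (1 / 2) ^ k * (η ^ n * (1 / 50) ^ d) * ((1 / u) ^ n * 9 ^ w) := by
    rw [mul_pow, mul_pow]
    ring
  linarith

/-- The expectation of `one_le_converse_sum`: Markov's inequality for errors and sensitive times,
Chernoff's for the weight. The base `0.918 = 0.9 * 1.02` combines the tilted source with `1 + z` at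
`z = 1 / 50`. -/
theorem Code.IsCausal.one_le {c : Code n} (hc : c.IsCausal) (hn : 0 < n) {u v r η : ℝ}
    (hu : 1 ≤ u) (hu' : u ^ 20 = 9) (hv : 1 ≤ v) (hv' : v ^ 20 = 2) (hr : 1 ≤ r)
    (hr' : r ^ 4 = 2) (hη : 1 ≤ η) (hη' : η ^ 400 = 50) :
    1 ≤ 400 * c.distortion 0.1 0.5 + 8 * c.cost 0.1 0.5 + (0.95 * v) ^ n +
      (0.918 * (r * η * (1 / u))) ^ n := by
  have hn' : (0 : ℝ) < n := by exact_mod_cast hn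
  have hx := hc.causalMap
  have main := expect_mono (p₁ := 0.1) (p₂ := 0.5) (by norm_num) (by norm_num) (by norm_num)
    (by norm_num) fun s₁ s₂ => one_le_converse_sum hn hu hu' hv hv' hr hr' hη hη'
      (dist s₁ (c.dec (c.enc s₂ + s₁ + s₂))) (sensitive c.enc s₂).card (weight s₁)
  rw [expect_const, expect_add, expect_add, expect_add, expect_const_mul] at main
  have e1 : expect 0.1 0.5 (fun s₁ s₂ => (dist s₁ (c.dec (c.enc s₂ + s₁ + s₂)) : ℝ) / n) =
      c.distortion 0.1 0.5 := c.distortion_eq.symm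
  have e2 : expect 0.1 0.5 (fun _ s₂ : Word n => 4 * (((sensitive c.enc s₂).card : ℝ) / n)) ≤
      8 * c.cost 0.1 0.5 := by
    rw [c.cost_eq, expect_const_mul, expect_snd, expect_snd]
    simp only [wordProb_half, ← Finset.mul_sum, ← Finset.sum_div]
    have := sum_card_sensitive_le c.enc
    calc _ ≤ 4 * ((1 / 2 : ℝ) ^ n * ((2 * ∑ s, (weight (c.enc s) : ℝ)) / n)) := by gcongr
      _ = _ := by ring
  have e3 : expect 0.1 0.5 (fun s₁ _ : Word n => v ^ n * (1 / 2 : ℝ) ^ weight s₁) =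
      (0.95 * v) ^ n := by
    rw [expect_const_mul, expect_fst, sum_wordProb_mul_pow_weight, mul_pow, mul_comm]
    norm_num
  have e4 : expect 0.1 0.5 (fun s₁ s₂ : Word n => (r * η * (1 / u)) ^ n *
      ((1 / 2 : ℝ) ^ (sensitive c.enc s₂).card *
        (1 / 50) ^ dist s₁ (c.dec (c.enc s₂ + s₁ + s₂)) * 9 ^ weight s₁)) ≤
      (0.918 * (r * η * (1 / u))) ^ n := by
    rw [expect_const_mul, mul_pow (0.918 : ℝ), mul_comm]
    refine mul_le_mul_of_nonneg_right ?_ (by positivity)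
    -- The factor `9 = 0.9 / 0.1` cancels the bias of the source, so that all `s₁` count equally.
    have hp : ∀ s : Word n, wordProb (0.1 : ℝ) s * 9 ^ weight s = 0.9 ^ n := fun s => by
      rw [wordProb_eq (by norm_num), mul_assoc, ← mul_pow]
      norm_num
    have e : ∀ s₁ s₂ : Word n, wordProb (0.1 : ℝ) s₁ * wordProb (0.5 : ℝ) s₂ *
        ((1 / 2 : ℝ) ^ (sensitive c.enc s₂).card *
          (1 / 50) ^ dist s₁ (c.dec (c.enc s₂ + s₁ + s₂)) * 9 ^ weight s₁) =
        0.9 ^ n * (1 / 2) ^ n * ((1 / 2 : ℝ) ^ (sensitive c.enc s₂).card *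
          (1 / 50) ^ dist s₁ (c.dec (c.enc s₂ + s₁ + s₂))) := fun s₁ s₂ => by
      rw [wordProb_half, ← hp s₁]
      ring
    simp only [expect, e, ← Finset.mul_sum]
    refine (mul_le_mul_of_nonneg_left (hx.sum_sensitive_dist_le c.dec (z := 1 / 50)
      (by norm_num)) (by positivity)).trans_eq ?_
    rw [← mul_pow, ← mul_pow, ← mul_pow]
    norm_num
  rw [e1, e3] at main
  linarith

end Converse

theorem achievable_causal_lower_bound {D : ℝ} (h : Achievable causal 0.1 0.5 0.11 D) :
    0.0001 ≤ D := by
  obtain ⟨u, hu, hu'⟩ := exists_one_le_pow_eq (b := 9) (by norm_num) (m := 20) (by norm_num)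
  obtain ⟨v, hv, hv'⟩ := exists_one_le_pow_eq (b := 2) (by norm_num) (m := 20) (by norm_num)
  obtain ⟨r, hr, hr'⟩ := exists_one_le_pow_eq (b := 2) (by norm_num) (m := 4) (by norm_num)
  obtain ⟨η, hη, hη'⟩ := exists_one_le_pow_eq (b := 50) (by norm_num) (m := 400) (by norm_num)
  have hv1 : 0.95 * v < 1 := by
    refine lt_of_pow_lt_pow_left₀ 20 zero_le_one ?_
    rw [mul_pow, hv']
    norm_num
  have hη1 : η ^ 20 < 1.25 := by
    refine lt_of_pow_lt_pow_left₀ 20 (by norm_num) ?_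
    rw [← pow_mul, hη']
    norm_num
  have hb1 : 0.918 * (r * η * (1 / u)) < 1 := by
    refine lt_of_pow_lt_pow_left₀ 20 zero_le_one ?_
    have : (0.918 * (r * η * (1 / u))) ^ 20 = 0.918 ^ 20 * ((r ^ 4) ^ 5 * η ^ 20 / u ^ 20) := by
      ring
    rw [this, hu', hr']
    calc _ ≤ (0.918 : ℝ) ^ 20 * (2 ^ 5 * 1.25 / 9) := by gcongr
      _ < _ := by norm_num
  refine le_of_achievable (by norm_num) (by norm_num) (by norm_num) (by norm_num) ?_ h
  intro c ε hc hcost hε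
  have t1 := tendsto_pow_atTop_nhds_zero_of_lt_one (by positivity : 0 ≤ 0.95 * v) hv1
  have t2 := tendsto_pow_atTop_nhds_zero_of_lt_one
    (by positivity : 0 ≤ 0.918 * (r * η * (1 / u))) hb1
  filter_upwards [eventually_gt_atTop 0, hε.eventually (gt_mem_nhds (by norm_num : (0 : ℝ) < 0.002)),
    t1.eventually (gt_mem_nhds (by norm_num : (0 : ℝ) < 0.01)),
    t2.eventually (gt_mem_nhds (by norm_num : (0 : ℝ) < 0.01))] with n hn h1 h2 h3
  -- Here `8 * 0.112 + 0.02 = 0.916`, which leaves at least `0.084 / 400` for the distortion.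
  have := Code.IsCausal.one_le (hc n) hn hu hu' hv hv' hr hr' hη hη'
  have := hcost n
  norm_num at *
  linarith

/-! ### Random linear hashing. -/

section Hash

open Matrix

/-- By the second moment method, a map with few collisions misses few values. -/
theorem card_missed_mul_sq_le {α β : Type*} [Fintype β] [Nonempty β] [DecidableEq β] (f : α → β)
    (B : Finset α) :
    ((Finset.univ.filter fun t => ∀ x ∈ B, f x ≠ t).card : ℝ) *
      ((B.card : ℝ) / Fintype.card β) ^ 2 ≤
      (∑ x ∈ B, ∑ y ∈ B, if f x = f y then (1 : ℝ) else 0) -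
        (B.card : ℝ) ^ 2 / Fintype.card β := by
  have hq : (Fintype.card β : ℝ) ≠ 0 := by exact_mod_cast Fintype.card_ne_zero
  set μ : ℝ := (B.card : ℝ) / Fintype.card β with hμ
  set N : β → ℝ := fun t => ∑ x ∈ B, if f x = t then 1 else 0 with hN
  have h1 : ∑ t, N t = B.card := by
    rw [Finset.sum_comm]
    simp
  have h2 : ∑ t, N t ^ 2 = ∑ x ∈ B, ∑ y ∈ B, if f x = f y then (1 : ℝ) else 0 := by
    simp only [hN, sq, Finset.sum_mul_sum]
    rw [Finset.sum_comm]
    refine Finset.sum_congr rfl fun x _ => ?_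
    rw [Finset.sum_comm]
    refine Finset.sum_congr rfl fun y _ => ?_
    simp [eq_comm]
  have h3 : ∑ t, (N t - μ) ^ 2 = ∑ t, N t ^ 2 - (B.card : ℝ) ^ 2 / Fintype.card β := by
    have : ∀ t, (N t - μ) ^ 2 = N t ^ 2 - 2 * μ * N t + μ ^ 2 := fun t => by ring
    simp only [this, Finset.sum_add_distrib, Finset.sum_sub_distrib, ← Finset.mul_sum, h1,
      Finset.sum_const, Finset.card_univ, nsmul_eq_mul]
    rw [hμ]
    field_simp
    ring
  rw [← h2, ← h3, ← nsmul_eq_mul, ← Finset.sum_const]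
  -- Each missed value has `N t = 0` and so contributes exactly `μ ^ 2` to the sum of squared
  -- deviations.
  refine (Finset.sum_le_sum fun t ht => ?_).trans
    (Finset.sum_le_sum_of_subset_of_nonneg (Finset.subset_univ _) fun t _ _ => sq_nonneg _)
  have : N t = 0 := Finset.sum_eq_zero fun x hx => if_neg ((Finset.mem_filter.1 ht).2 x hx)
  rw [this]
  simp

variable {m n : ℕ}

theorem surjective_mulVec {z : Word n} (hz : z ≠ 0) :
    Function.Surjective fun H : Matrix (Fin m) (Fin n) Bit => H *ᵥ z := by
  obtain ⟨i, hi⟩ := Function.ne_iff.1 hz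
  have hi : z i = 1 := (bit_cases (z i)).resolve_left hi
  intro t
  refine ⟨Matrix.of fun j k => if k = i then t j else 0, ?_⟩
  ext j
  simp [Matrix.mulVec, dotProduct, hi]

/-- All fibres of a surjective homomorphism have the same size, so a uniform matrix sends a nonzero
word to a uniform value. -/
theorem card_mulVec_eq_zero {z : Word n} (hz : z ≠ 0) :
    (Finset.univ.filter fun H : Matrix (Fin m) (Fin n) Bit => H *ᵥ z = 0).card * 2 ^ m =
      Fintype.card (Matrix (Fin m) (Fin n) Bit) := by
  let f : Matrix (Fin m) (Fin n) Bit →+ Word m :=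
    ⟨⟨fun H => H *ᵥ z, Matrix.zero_mulVec z⟩, fun H K => Matrix.add_mulVec H K z⟩
  have hf : Function.Surjective f := surjective_mulVec hz
  have h := Finset.card_eq_sum_card_fiberwise (f := f) (s := Finset.univ)
    (t := Finset.univ) fun _ _ => Finset.mem_coe.2 (Finset.mem_univ _)
  rw [Finset.sum_congr rfl fun t _ =>
    AddMonoidHom.card_fiber_eq_of_mem_range f (hf t) (hf 0), Finset.sum_const] at h
  rw [← Finset.card_univ (α := Matrix (Fin m) (Fin n) Bit), h, Finset.card_univ, smul_eq_mul,
    mul_comm]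
  simp [ZMod.card, f]

theorem sum_mulVec_eq {s t : Word n} (h : s ≠ t) :
    ∑ H : Matrix (Fin m) (Fin n) Bit, (if H *ᵥ s = H *ᵥ t then (1 : ℝ) else 0) =
      Fintype.card (Matrix (Fin m) (Fin n) Bit) / 2 ^ m := by
  rw [← card_mulVec_eq_zero (m := m) (sub_ne_zero.2 h), Finset.sum_boole]
  simp only [Matrix.mulVec_sub, sub_eq_zero]
  push_cast
  field_simp

theorem sum_collisions_le {p : ℝ} (h0 : 0 ≤ p) (h1 : p ≤ 1) (m : ℕ) (T : Finset (Word n)) :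
    ∑ H : Matrix (Fin m) (Fin n) Bit,
      ∑ s ∈ T, wordProb p s * (∑ t ∈ T.erase s, if H *ᵥ t = H *ᵥ s then (1 : ℝ) else 0) ≤
      Fintype.card (Matrix (Fin m) (Fin n) Bit) * ((T.card : ℝ) / 2 ^ m) := by
  generalize hc : (Fintype.card (Matrix (Fin m) (Fin n) Bit) : ℝ) = c
  have hc0 : 0 ≤ c := hc ▸ Nat.cast_nonneg _
  rw [Finset.sum_comm]
  have : ∀ s ∈ T, ∑ H : Matrix (Fin m) (Fin n) Bit,
      wordProb p s * (∑ t ∈ T.erase s, if H *ᵥ t = H *ᵥ s then (1 : ℝ) else 0) ≤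
      wordProb p s * (c * ((T.card : ℝ) / 2 ^ m)) := fun s _ => by
    rw [← Finset.mul_sum, Finset.sum_comm]
    refine mul_le_mul_of_nonneg_left ?_ (wordProb_nonneg h0 h1 s)
    rw [Finset.sum_congr rfl fun t ht => sum_mulVec_eq (Finset.ne_of_mem_erase ht),
      Finset.sum_const, nsmul_eq_mul, hc]
    have : ((T.erase s).card : ℝ) ≤ T.card := by
      exact_mod_cast Finset.card_le_card (Finset.erase_subset s T)
    calc _ ≤ (T.card : ℝ) * (c / 2 ^ m) := by gcongr
      _ = _ := by ring
  refine (Finset.sum_le_sum this).trans ?_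
  rw [← Finset.sum_mul]
  refine mul_le_of_le_one_left (by positivity) ?_
  rw [← sum_wordProb (n := n) p]
  exact Finset.sum_le_sum_of_subset_of_nonneg (Finset.subset_univ _) fun s _ _ =>
    wordProb_nonneg h0 h1 s

theorem sum_sum_collisions_le (m : ℕ) (B : Finset (Word n)) :
    ∑ H : Matrix (Fin m) (Fin n) Bit,
      (∑ x ∈ B, ∑ y ∈ B, if H *ᵥ x = H *ᵥ y then (1 : ℝ) else 0) ≤
      Fintype.card (Matrix (Fin m) (Fin n) Bit) * B.card +
        Fintype.card (Matrix (Fin m) (Fin n) Bit) * ((B.card : ℝ) ^ 2 / 2 ^ m) := by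
  generalize hc : (Fintype.card (Matrix (Fin m) (Fin n) Bit) : ℝ) = c
  have hc0 : 0 ≤ c := hc ▸ Nat.cast_nonneg _
  rw [Finset.sum_comm]
  have : ∀ x ∈ B, ∑ H : Matrix (Fin m) (Fin n) Bit,
      (∑ y ∈ B, if H *ᵥ x = H *ᵥ y then (1 : ℝ) else 0) ≤ c + B.card * (c / 2 ^ m) := by
    intro x hx
    rw [Finset.sum_comm, ← Finset.add_sum_erase B _ hx,
      Finset.sum_congr rfl fun y hy => sum_mulVec_eq (Finset.ne_of_mem_erase hy).symm,
      Finset.sum_const, nsmul_eq_mul, hc]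
    have : ((B.erase x).card : ℝ) ≤ B.card := by
      exact_mod_cast Finset.card_le_card (Finset.erase_subset x B)
    refine add_le_add (le_of_eq ?_) (mul_le_mul_of_nonneg_right this (by positivity))
    rw [← hc, Finset.sum_congr rfl fun H _ => if_pos rfl, Finset.sum_const, Finset.card_univ,
      nsmul_eq_mul, mul_one]
  refine (Finset.sum_le_sum this).trans_eq ?_
  rw [Finset.sum_const, nsmul_eq_mul]
  ring

theorem div_le_of_second_moment {b c q M S : ℝ} (hb : 0 < b) (hq : 0 < q)
    (hM : M * (b / q) ^ 2 ≤ S - c * (b ^ 2 / q)) (hS : S ≤ c * b + c * (b ^ 2 / q)) :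
    M / q ≤ c * (q / b) := by
  have h : M * (b / q) ^ 2 ≤ c * b := by linarith
  rw [div_le_iff₀ hq, show c * (q / b) * q = c * b / (b / q) ^ 2 by field_simp,
    le_div_iff₀ (by positivity)]
  exact h

theorem sum_card_missed_le (m : ℕ) (B : Finset (Word n)) (hB : B.Nonempty) :
    ∑ H : Matrix (Fin m) (Fin n) Bit,
      ((Finset.univ.filter fun t : Word m => ∀ x ∈ B, H *ᵥ x ≠ t).card : ℝ) / 2 ^ m ≤
      Fintype.card (Matrix (Fin m) (Fin n) Bit) * (2 ^ m / B.card) := by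
  have hB' : (0 : ℝ) < B.card := by exact_mod_cast hB.card_pos
  have hcoll := sum_sum_collisions_le m B
  have hcard : (Fintype.card (Word m) : ℝ) = 2 ^ m := by simp [ZMod.card]
  have hpt : ∀ H : Matrix (Fin m) (Fin n) Bit,
      ((Finset.univ.filter fun t : Word m => ∀ x ∈ B, H *ᵥ x ≠ t).card : ℝ) *
        ((B.card : ℝ) / 2 ^ m) ^ 2 ≤
      (∑ x ∈ B, ∑ y ∈ B, if H *ᵥ x = H *ᵥ y then (1 : ℝ) else 0) - (B.card : ℝ) ^ 2 / 2 ^ m :=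
    fun H => by
      have h := card_missed_mul_sq_le (fun x => H *ᵥ x) B
      rw [hcard] at h
      convert h
  have hm := Finset.sum_le_sum fun (H : Matrix (Fin m) (Fin n) Bit)
    (_ : H ∈ Finset.univ) => hpt H
  rw [← Finset.sum_mul, Finset.sum_sub_distrib, Finset.sum_const, Finset.card_univ,
    nsmul_eq_mul] at hm
  rw [← Finset.sum_div]
  exact div_le_of_second_moment hB' (by positivity) hm hcoll

/-- Some linear map has few collisions on `T`, on average, and takes most of the values on `B`. -/
theorem exists_hash {p : ℝ} (h0 : 0 ≤ p) (h1 : p ≤ 1) (m : ℕ) (T B : Finset (Word n))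
    (hB : B.Nonempty) :
    ∃ H : Matrix (Fin m) (Fin n) Bit,
      ∑ s ∈ T, wordProb p s * (∑ t ∈ T.erase s, if H *ᵥ t = H *ᵥ s then 1 else 0) +
        ((Finset.univ.filter fun t : Word m => ∀ x ∈ B, H *ᵥ x ≠ t).card : ℝ) / 2 ^ m ≤
      (T.card : ℝ) / 2 ^ m + 2 ^ m / B.card := by
  obtain ⟨H, -, hH⟩ := Finset.exists_le_of_sum_le (s := Finset.univ)
    (f := fun H : Matrix (Fin m) (Fin n) Bit =>
      ∑ s ∈ T, wordProb p s * (∑ t ∈ T.erase s, if H *ᵥ t = H *ᵥ s then (1 : ℝ) else 0) +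
        ((Finset.univ.filter fun t : Word m => ∀ x ∈ B, H *ᵥ x ≠ t).card : ℝ) / 2 ^ m)
    (g := fun _ => (T.card : ℝ) / 2 ^ m + 2 ^ m / B.card) Finset.univ_nonempty (by
      rw [Finset.sum_add_distrib, Finset.sum_const, Finset.card_univ, nsmul_eq_mul, mul_add]
      exact add_le_add (sum_collisions_le h0 h1 m T) (sum_card_missed_le m B hB))
  exact ⟨H, hH⟩

/-- Some shift of the hash values keeps the probability of a missed value at its average. -/
theorem exists_shift (p : ℝ) (H : Matrix (Fin m) (Fin n) Bit) (B : Finset (Word n)) :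
    ∃ u : Word m, ∑ s : Word n, wordProb p s * (if ∀ x ∈ B, H *ᵥ x ≠ u + H *ᵥ s then 1 else 0) ≤
      ((Finset.univ.filter fun t : Word m => ∀ x ∈ B, H *ᵥ x ≠ t).card : ℝ) / 2 ^ m := by
  obtain ⟨u, -, hu⟩ := Finset.exists_le_of_sum_le (s := Finset.univ)
    (f := fun u : Word m => ∑ s : Word n,
      wordProb p s * (if ∀ x ∈ B, H *ᵥ x ≠ u + H *ᵥ s then (1 : ℝ) else 0))
    (g := fun _ =>
      ((Finset.univ.filter fun t : Word m => ∀ x ∈ B, H *ᵥ x ≠ t).card : ℝ) / 2 ^ m)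
    Finset.univ_nonempty (by
      rw [Finset.sum_comm]
      have : ∀ s : Word n, ∑ u : Word m,
          wordProb p s * (if ∀ x ∈ B, H *ᵥ x ≠ u + H *ᵥ s then (1 : ℝ) else 0) =
          wordProb p s *
            ((Finset.univ.filter fun t : Word m => ∀ x ∈ B, H *ᵥ x ≠ t).card : ℝ) := fun s => by
        rw [← Finset.mul_sum, ← Finset.sum_boole]
        congr 1
        -- For each `s`, the target `u + H s` is uniform when `u` is.
        exact Equiv.sum_comp (Equiv.addRight (H *ᵥ s))
          fun t => if ∀ x ∈ B, H *ᵥ x ≠ t then (1 : ℝ) else 0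
      simp only [this]
      rw [← Finset.sum_mul, sum_wordProb, Finset.sum_const, Finset.card_univ, nsmul_eq_mul]
      simp [ZMod.card, mul_div_cancel₀])
  exact ⟨u, hu⟩

open Classical in
/-- The encoder moves the hash value of the interference to `u` by means of a word of `B`; the
decoder looks for a word of `T` with the hash value that this leaves. -/
noncomputable def hashCode (H : Matrix (Fin m) (Fin n) Bit) (u : Word m) (T B : Finset (Word n)) : Code n where
  enc s := if h : ∃ x ∈ B, H *ᵥ x = u + H *ᵥ s then h.choose else 0
  dec y := if h : ∃ s ∈ T, H *ᵥ s = u + H *ᵥ y then h.choose else 0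

theorem hashCode_enc_of_exists {H : Matrix (Fin m) (Fin n) Bit} {u : Word m}
    {T B : Finset (Word n)} {s : Word n} (h : ∃ x ∈ B, H *ᵥ x = u + H *ᵥ s) :
    (hashCode H u T B).enc s ∈ B ∧ H *ᵥ (hashCode H u T B).enc s = u + H *ᵥ s := by
  have henc : (hashCode H u T B).enc s = h.choose := dif_pos h
  rw [henc]
  exact h.choose_spec

theorem hashCode_dec_output {H : Matrix (Fin m) (Fin n) Bit} {u : Word m} {T B : Finset (Word n)}
    {s₁ s₂ : Word n} (h₁ : s₁ ∈ T) (h₂ : ∃ x ∈ B, H *ᵥ x = u + H *ᵥ s₂)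
    (h : ∀ t ∈ T.erase s₁, H *ᵥ t ≠ H *ᵥ s₁) :
    (hashCode H u T B).dec ((hashCode H u T B).output s₁ s₂) = s₁ := by
  have hy : u + H *ᵥ (hashCode H u T B).output s₁ s₂ = H *ᵥ s₁ := by
    change u + H *ᵥ ((hashCode H u T B).enc s₂ + s₁ + s₂) = _
    rw [Matrix.mulVec_add, Matrix.mulVec_add, (hashCode_enc_of_exists h₂).2]
    have h2 : ∀ t : Word m, t + t = 0 := fun t => funext fun i => CharTwo.add_self_eq_zero (t i)
    calc _ = (u + u) + (H *ᵥ s₂ + H *ᵥ s₂) + H *ᵥ s₁ := by abel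
      _ = _ := by rw [h2, h2, add_zero, zero_add]
  have hex : ∃ s ∈ T, H *ᵥ s = u + H *ᵥ (hashCode H u T B).output s₁ s₂ := ⟨s₁, h₁, hy.symm⟩
  have hdec : (hashCode H u T B).dec ((hashCode H u T B).output s₁ s₂) = hex.choose :=
    dif_pos hex
  rw [hdec]
  by_contra hne
  exact h _ (Finset.mem_erase.2 ⟨hne, hex.choose_spec.1⟩) (hex.choose_spec.2.trans hy)

theorem weight_zero : weight (0 : Word n) = 0 := by simp [weight]

/-- Decoding fails only if `s₁` is outside `T`, collides in `T`, or the encoder's target hash is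
missed by `B`; a failure costs at most `1`. -/
theorem exists_code {p₁ p₂ a : ℝ} (h₁ : 0 ≤ p₁) (h₁' : p₁ ≤ 1) (h₂ : 0 ≤ p₂) (h₂' : p₂ ≤ 1)
    (ha : 0 ≤ a) (m : ℕ) (T B : Finset (Word n)) (hB : B.Nonempty)
    (hBa : ∀ x ∈ B, (weight x : ℝ) / n ≤ a) :
    ∃ c : Code n, c.cost p₁ p₂ ≤ a ∧ c.distortion p₁ p₂ ≤
      ∑ s : Word n, wordProb p₁ s * (if s ∈ T then 0 else 1) +
        ((T.card : ℝ) / 2 ^ m + 2 ^ m / B.card) := by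
  obtain ⟨H, hH⟩ := exists_hash h₁ h₁' m T B hB
  obtain ⟨u, hu⟩ := exists_shift p₂ H B
  refine ⟨hashCode H u T B, ?_, ?_⟩
  · rw [Code.cost_eq, ← expect_const (n := n) (p₁ := p₁) (p₂ := p₂) a]
    refine expect_mono h₁ h₁' h₂ h₂' fun _ s => ?_
    by_cases h : ∃ x ∈ B, H *ᵥ x = u + H *ᵥ s
    · exact hBa _ (hashCode_enc_of_exists h).1
    · have henc : (hashCode H u T B).enc s = 0 := dif_neg h
      simpa [henc, weight_zero] using ha
  · have key : ∀ s₁ s₂ : Word n,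
        (dist s₁ ((hashCode H u T B).dec ((hashCode H u T B).output s₁ s₂)) : ℝ) / n ≤
        (if s₁ ∈ T then 0 else 1) +
          (if s₁ ∈ T then ∑ t ∈ T.erase s₁, (if H *ᵥ t = H *ᵥ s₁ then (1 : ℝ) else 0) else 0) +
          (if ∀ x ∈ B, H *ᵥ x ≠ u + H *ᵥ s₂ then 1 else 0) := by
      intro s₁ s₂
      have hle : (dist s₁ ((hashCode H u T B).dec ((hashCode H u T B).output s₁ s₂)) : ℝ) / n ≤ 1 :=
        div_le_one_of_le₀ (by exact_mod_cast dist_le _ _) (by positivity)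
      have hnn : 0 ≤ ∑ t ∈ T.erase s₁, (if H *ᵥ t = H *ᵥ s₁ then (1 : ℝ) else 0) :=
        Finset.sum_nonneg fun t _ => by split_ifs <;> norm_num
      by_cases hT : s₁ ∈ T
      · rw [if_pos hT, if_pos hT, zero_add]
        by_cases hx : ∀ x ∈ B, H *ᵥ x ≠ u + H *ᵥ s₂
        · rw [if_pos hx]
          linarith
        rw [if_neg hx, add_zero]
        by_cases hc : ∀ t ∈ T.erase s₁, H *ᵥ t ≠ H *ᵥ s₁
        · rw [hashCode_dec_output hT (by simpa using hx) hc, dist_self]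
          simp
        · push Not at hc
          obtain ⟨t, ht, hts⟩ := hc
          refine hle.trans ((show (1 : ℝ) ≤ if H *ᵥ t = H *ᵥ s₁ then 1 else 0 by rw [if_pos hts]).trans ?_)
          exact Finset.single_le_sum
            (f := fun t => if H *ᵥ t = H *ᵥ s₁ then (1 : ℝ) else 0)
            (fun t _ => by split_ifs <;> norm_num) ht
      · rw [if_neg hT, if_neg hT]
        have : (0 : ℝ) ≤ if ∀ x ∈ B, H *ᵥ x ≠ u + H *ᵥ s₂ then 1 else 0 := by
          split_ifs <;> norm_num
        linarith
    rw [Code.distortion_eq]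
    refine (expect_mono h₁ h₁' h₂ h₂' key).trans ?_
    rw [expect_add, expect_add, expect_fst, expect_fst, expect_snd]
    simp only [mul_ite (_ ∈ T), mul_zero, Finset.sum_ite_mem, Finset.univ_inter]
    simp only [mul_ite, mul_zero, mul_one] at hu hH ⊢
    linarith

end Hash

/-! ### Growth of Hamming balls. -/

section Ball

/-- The words of weight at most `r`. -/
def ball (n r : ℕ) : Finset (Word n) := Finset.univ.filter fun s => weight s ≤ r

theorem card_weight_eq (n k : ℕ) :
    (Finset.univ.filter fun s : Word n => weight s = k).card = n.choose k := by
  have h := Finset.card_powersetCard k (Finset.univ : Finset (Fin n))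
  rw [Finset.card_univ, Fintype.card_fin] at h
  rw [← h]
  refine Finset.card_bij (fun s _ => Finset.univ.filter fun i => s i = 1) ?_ ?_ ?_
  · intro s hs
    exact Finset.mem_powersetCard.2 ⟨Finset.subset_univ _, (Finset.mem_filter.1 hs).2⟩
  · intro s _ t _ h
    ext1 i
    have hi : s i = 1 ↔ t i = 1 := by simpa using Finset.ext_iff.1 h i
    rcases bit_cases (s i) with h0 | h0 <;> rcases bit_cases (t i) with h1 | h1 <;> simp_all
  · intro A hA
    refine ⟨fun i => if i ∈ A then 1 else 0, ?_, ?_⟩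
    · refine Finset.mem_filter.2 ⟨Finset.mem_univ _, ?_⟩
      simpa [weight] using (Finset.mem_powersetCard.1 hA).2
    · ext i
      simp

theorem card_ball (n r : ℕ) : (ball n r).card = ∑ k ∈ Finset.range (r + 1), n.choose k := by
  rw [ball, Finset.card_eq_sum_card_fiberwise (f := weight) (t := Finset.range (r + 1))]
  · refine Finset.sum_congr rfl fun k hk => ?_
    rw [← card_weight_eq, Finset.filter_filter]
    congr 1
    ext s
    have := Finset.mem_range.1 hk
    simp only [Finset.mem_filter, Finset.mem_univ, true_and]
    omega
  · intro s hs
    simpa [Nat.lt_succ_iff] using hs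

/-- The ratio of consecutive binomials `(n - k) / (k + 1)` is at least `2` for `k ≤ r`. -/
theorem two_mul_card_ball_le {n r : ℕ} (h : 3 * (r + 1) ≤ n) :
    2 * (ball n r).card ≤ (ball n (r + 1)).card := by
  rw [card_ball, card_ball, Finset.sum_range_succ' _ (r + 1), Finset.mul_sum]
  refine (Finset.sum_le_sum fun k hk => ?_).trans (Nat.le_add_right _ _)
  have hk := Finset.mem_range.1 hk
  refine Nat.le_of_mul_le_mul_right (c := k + 1) ?_ k.succ_pos
  rw [Nat.choose_succ_right_eq, mul_comm 2, mul_assoc]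
  exact Nat.mul_le_mul_left _ (by omega)

theorem two_pow_mul_card_ball_le {n r i : ℕ} (h : 3 * (r + i) ≤ n) :
    2 ^ i * (ball n r).card ≤ (ball n (r + i)).card := by
  induction i with
  | zero => simp
  | succ i ih =>
    calc 2 ^ (i + 1) * (ball n r).card = 2 * (2 ^ i * (ball n r).card) := by ring
      _ ≤ 2 * (ball n (r + i)).card := Nat.mul_le_mul_left _ (ih (by omega))
      _ ≤ _ := two_mul_card_ball_le (by omega)

theorem ball_nonempty (n r : ℕ) : (ball n r).Nonempty :=
  ⟨0, by simp [ball, weight_zero]⟩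

end Ball

/-! ### Choice of parameters and conclusion. -/

theorem exists_code_small_distortion (n : ℕ) {h : ℝ} (hh : 1 ≤ h) (hh' : h ^ 200 = 1.05) :
    ∃ c : Code n, c.cost 0.1 0.5 ≤ 0.11 ∧
      c.distortion 0.1 0.5 ≤ (1.005 * (1 / h) ^ 21) ^ n + 3 * (1 / 2) ^ (n / 1000) := by
  set j := n / 1000 with hj
  set r := 21 * n / 200 with hr
  have hT0 : 0 < (ball n r).card := (ball_nonempty n r).card_pos
  set l := Nat.log 2 (ball n r).card with hl
  -- With `m = l + j`, the hash range exceeds `T` by a factor of about `2 ^ j`, while `B` is at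
  -- least `4 ^ j` times `T`. Since `2 * j ≤ 0.002 n`, words of `B` have weight at most `0.107 n`.
  obtain ⟨c, hc, hd⟩ := exists_code (p₁ := 0.1) (p₂ := 0.5) (a := 0.11) (by norm_num)
    (by norm_num) (by norm_num) (by norm_num) (by norm_num) (l + j) (ball n r)
    (ball n (r + 2 * j)) (ball_nonempty n _) (by
      intro x hx
      have hx := (Finset.mem_filter.1 hx).2
      refine div_le_of_le_mul₀ (by positivity) (by norm_num) ?_
      have : 100 * weight x ≤ 11 * n := by omega
      have : (100 : ℝ) * weight x ≤ 11 * n := by exact_mod_cast this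
      linarith)
  refine ⟨c, hc, hd.trans (add_le_add ?_ ?_)⟩
  -- Chernoff bound with tilt `1.05`: the mean of `1.05 ^ weight s` is `(0.9 + 0.105) ^ n`.
  · calc _ ≤ ∑ s : Word n, wordProb (0.1 : ℝ) s * ((1 / h) ^ (21 * n) * 1.05 ^ weight s) := by
          refine Finset.sum_le_sum fun s _ => mul_le_mul_of_nonneg_left ?_
            (wordProb_nonneg (by norm_num) (by norm_num) s)
          split_ifs with hs
          · positivity
          · refine one_le_inv_pow_mul_pow hh hh' ?_
            have : ¬ weight s ≤ r := fun h => hs (Finset.mem_filter.2 ⟨Finset.mem_univ _, h⟩)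
            omega
      _ = (1 / h) ^ (21 * n) * ∑ s : Word n, wordProb (0.1 : ℝ) s * 1.05 ^ weight s := by
          rw [Finset.mul_sum]
          exact Finset.sum_congr rfl fun s _ => by ring
      _ = _ := by
          rw [sum_wordProb_mul_pow_weight, pow_mul, ← mul_pow, mul_comm]
          norm_num
  · have hT : ((ball n r).card : ℝ) ≤ 2 * 2 ^ l := by
      have := (Nat.lt_pow_succ_log_self one_lt_two (ball n r).card).le
      rw [pow_succ'] at this
      exact_mod_cast this
    have hT' : (2 : ℝ) ^ l ≤ (ball n r).card := by
      exact_mod_cast Nat.pow_log_le_self 2 hT0.ne'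
    have hB : (2 : ℝ) ^ (2 * j) * (ball n r).card ≤ (ball n (r + 2 * j)).card := by
      exact_mod_cast two_pow_mul_card_ball_le (by omega)
    have hB' : (0 : ℝ) < (ball n (r + 2 * j)).card := by
      exact_mod_cast (ball_nonempty n _).card_pos
    have i1 : ((ball n r).card : ℝ) / 2 ^ (l + j) ≤ 2 * (1 / 2) ^ j := by
      rw [div_le_iff₀ (by positivity), pow_add, one_div, inv_pow]
      calc _ ≤ _ := hT
        _ = _ := by field_simp
    have i2 : (2 : ℝ) ^ (l + j) / (ball n (r + 2 * j)).card ≤ (1 / 2) ^ j := by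
      rw [div_le_iff₀ hB']
      calc (2 : ℝ) ^ (l + j) = (1 / 2) ^ j * (2 ^ (2 * j) * 2 ^ l) := by
            rw [one_div, inv_pow, pow_add, two_mul, pow_add]
            field_simp
        _ ≤ (1 / 2) ^ j * (2 ^ (2 * j) * (ball n r).card) := by gcongr
        _ ≤ _ := by gcongr
    linarith

theorem achievable_noncausal_zero : Achievable noncausal (0.1 : ℝ) (0.5 : ℝ) (0.11 : ℝ) 0 := by
  obtain ⟨h, hh, hh'⟩ := exists_one_le_pow_eq (b := 1.05) (by norm_num) (m := 200) (by norm_num)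
  choose c hc hd using fun n => exists_code_small_distortion n hh hh'
  refine ⟨c, 0, fun n => Set.mem_univ _, fun n => by simpa using hc n, tendsto_const_nhds, ?_⟩
  have hlt : 1.005 * (1 / h) ^ 21 < 1 := by
    refine lt_of_pow_lt_pow_left₀ 200 zero_le_one ?_
    have : (1.005 * (1 / h) ^ 21) ^ 200 = 1.005 ^ 200 / (h ^ 200) ^ 21 := by
      rw [mul_pow, one_div, ← pow_mul, inv_pow, ← pow_mul, ← div_eq_mul_inv]
    rw [this, hh']
    norm_num
  have t1 := tendsto_pow_atTop_nhds_zero_of_lt_one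
    (by positivity : 0 ≤ 1.005 * (1 / h) ^ 21) hlt
  have t2 := (tendsto_pow_atTop_nhds_zero_of_lt_one (by norm_num : (0 : ℝ) ≤ 1 / 2)
    (by norm_num)).comp (Nat.tendsto_div_const_atTop (show 1000 ≠ 0 by norm_num))
  have t3 := t1.add (t2.const_mul 3)
  rw [mul_zero, add_zero] at t3
  exact (squeeze_zero (fun n => (c n).distortion_nonneg (by norm_num) (by norm_num) (by norm_num)
    (by norm_num)) hd t3).limsup_eq.le

theorem minDistortion_noncausal_eq_zero :
    minDistortion noncausal (0.1 : ℝ) (0.5 : ℝ) (0.11 : ℝ) = 0 :=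
  IsLeast.csInf_eq ⟨achievable_noncausal_zero, fun _ hD =>
    nonneg_of_achievable (by norm_num) (by norm_num) (by norm_num) (by norm_num) hD⟩

theorem minDistortion_causal_pos :
    0 < minDistortion causal (0.1 : ℝ) (0.5 : ℝ) (0.11 : ℝ) :=
  lt_of_lt_of_le (by norm_num : (0 : ℝ) < 0.0001)
    -- The real infimum of the empty set is `0`, so positivity requires an achievable distortion.
    (le_csInf ⟨1, achievable_causal_one (by norm_num) (by norm_num) (by norm_num) (by norm_num)
      (by norm_num)⟩ fun _ hD => achievable_causal_lower_bound hD)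

end BinaryHelper

theorem proposition2 :
    (∃ p₁ p₂ C : ℝ, 0 ≤ p₁ ∧ p₁ ≤ 1 / 2 ∧ 0 ≤ p₂ ∧ p₂ ≤ 1 / 2 ∧ 0 ≤ C ∧
      BinaryHelper.minDistortion BinaryHelper.noncausal p₁ p₂ C <
        BinaryHelper.minDistortion BinaryHelper.causal p₁ p₂ C) ∧
    BinaryHelper.Achievable BinaryHelper.noncausal (0.1 : ℝ) (0.5 : ℝ) (0.11 : ℝ) 0 ∧
    BinaryHelper.minDistortion BinaryHelper.noncausal (0.1 : ℝ) (0.5 : ℝ) (0.11 : ℝ) = 0 ∧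
    0 < BinaryHelper.minDistortion BinaryHelper.causal (0.1 : ℝ) (0.5 : ℝ) (0.11 : ℝ) := by
  refine ⟨⟨0.1, 0.5, 0.11, by norm_num, by norm_num, by norm_num, by norm_num, by norm_num, ?_⟩,
    BinaryHelper.achievable_noncausal_zero, BinaryHelper.minDistortion_noncausal_eq_zero,
    BinaryHelper.minDistortion_causal_pos⟩
  rw [BinaryHelper.minDistortion_noncausal_eq_zero]
  exact BinaryHelper.minDistortion_causal_pos
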